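/- For $n\ge 0$ let $S_n(T)$ be the set of permutations of length $n$ that avoid, in the sense of classical pattern avoidance, every pattern in $T=\{1342,2143,2413\}$ (that is, no subsequence of the one-line notation is order-isomorphic to a pattern in $T$), and let $F_T(x)=\sum_{n\ge 0}|S_n(T)|\,x^n$. Then, as formal power series, $$F_T(x)=\frac{1-3x+x^2-\sqrt{(1-7x+13x^2-8x^3)(1-3x+x^2)}}{2x(1-x)(1-2x)},$$ where the square root denotes the formal power series with constant term $1$ whose square is the radicand. -/

import Mathlib

open PowerSeries

/-- The permutation `π` of `{0, …, n-1}` (one-line notation `π 0, π 1, …, π (n-1)`) contains the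
pattern `τ` (one-line notation `τ 0, …, τ (k-1)`, with distinct letters): some subsequence of `π`
of length `k` is order-isomorphic to `τ`. -/
def ContainsPattern {n k : ℕ} (π : Equiv.Perm (Fin n)) (τ : Fin k → ℕ) : Prop :=
  ∃ p : Fin k → Fin n, StrictMono p ∧ ∀ a b : Fin k, π (p a) < π (p b) ↔ τ a < τ b

/-- `S_n(T)`: the permutations of length `n` that contain no pattern of `T`. -/
def avoiders {k : ℕ} (T : Set (Fin k → ℕ)) (n : ℕ) : Set (Equiv.Perm (Fin n)) :=
  {π | ∀ τ ∈ T, ¬ ContainsPattern π τ}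

/-- `F_T(x) = ∑_{n ≥ 0} |S_n(T)| x^n`, as a formal power series. -/
noncomputable def avoiderGF {k : ℕ} (T : Set (Fin k → ℕ)) : ℚ⟦X⟧ :=
  PowerSeries.mk fun n => ((avoiders T n).ncard : ℚ)

/-! Cut a nonempty avoider at its maximum `n` as `L n R`. Let `B` be the letters of `L` above all of
`R`, `S` the other letters of `L`, `D` the letters of `R` below all of `S` when `S` is nonempty (all
of `R` otherwise), and `U` the rest of `R`. The three patterns force the shape `B S n U D` with
values `D < S < U < B < n`, where `S` is increasing, `U` avoids `231`, and `S` and `U` are empty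
together. Conversely, every such choice of avoiding blocks gives an avoider (`exists_decomposition`,
`mem_avoidingWords_of_decomposition`), and the blocks are determined by the word
(`decomposition_unique`).

Let G count the admissible `U`. Then F = 1 + x F² (1 + x/(1-x) · (G - 1)). Cutting a word counted by
G at its maximum gives (1 - 3x + x²)(G - 1) = x(1 - x). Eliminating G leaves a quadratic equation
for F (`avoiderGF_quadratic`), and the square root comes from completing the square. -/

/-- The letters `a b c d` are order-isomorphic to `1342`, `2143` or `2413`. -/
def IsForbiddenQuad (a b c d : ℕ) : Prop :=
  (a < d ∧ d < b ∧ b < c) ∨ (b < a ∧ a < d ∧ d < c) ∨ (c < a ∧ a < d ∧ d < b)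

/-- The word `l` avoids `1342`, `2143` and `2413`. -/
def AvoidsQuads (l : List ℕ) : Prop :=
  ∀ a b c d, [a, b, c, d].Sublist l → ¬ IsForbiddenQuad a b c d

/-- The word `l` avoids `231`. -/
def Avoids231 (l : List ℕ) : Prop :=
  ∀ a b c, [a, b, c].Sublist l → ¬ (c < a ∧ a < b)

theorem AvoidsQuads.sublist {l l' : List ℕ} (h : AvoidsQuads l) (hs : l'.Sublist l) :
    AvoidsQuads l' :=
  fun a b c d hq => h a b c d (hq.trans hs)

theorem Avoids231.sublist {l l' : List ℕ} (h : Avoids231 l) (hs : l'.Sublist l) :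
    Avoids231 l' :=
  fun a b c hq => h a b c (hq.trans hs)

/-! ### Avoidance in concatenated words -/

theorem triple_sublist_append {a b c : ℕ} {l₁ l₂ : List ℕ}
    (h : [a, b, c].Sublist (l₁ ++ l₂)) :
    [a, b, c].Sublist l₂ ∨ (a ∈ l₁ ∧ [b, c].Sublist l₂) ∨
      ([a, b].Sublist l₁ ∧ c ∈ l₂) ∨ [a, b, c].Sublist l₁ := by
  obtain ⟨s, t, he, hs, ht⟩ := List.sublist_append_iff.1 h
  rcases s with _ | ⟨x, _ | ⟨y, _ | ⟨z, s⟩⟩⟩ <;> simp_all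
  obtain ⟨rfl, rfl, rfl⟩ := he
  simp_all

theorem quad_sublist_append {a b c d : ℕ} {l₁ l₂ : List ℕ}
    (h : [a, b, c, d].Sublist (l₁ ++ l₂)) :
    [a, b, c, d].Sublist l₂ ∨ (a ∈ l₁ ∧ [b, c, d].Sublist l₂) ∨
      ([a, b].Sublist l₁ ∧ [c, d].Sublist l₂) ∨ ([a, b, c].Sublist l₁ ∧ d ∈ l₂) ∨
      [a, b, c, d].Sublist l₁ := by
  obtain ⟨s, t, he, hs, ht⟩ := List.sublist_append_iff.1 h
  rcases s with _ | ⟨x, _ | ⟨y, _ | ⟨z, _ | ⟨w, s⟩⟩⟩⟩ <;> simp_all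
  obtain ⟨rfl, rfl, rfl, rfl⟩ := he
  simp_all

/-- A skew sum of avoiders is an avoider. -/
theorem AvoidsQuads.append_of_gt {l₁ l₂ : List ℕ} (h₁ : AvoidsQuads l₁) (h₂ : AvoidsQuads l₂)
    (h : ∀ x ∈ l₁, ∀ y ∈ l₂, y < x) : AvoidsQuads (l₁ ++ l₂) := by
  intro a b c d hs hq
  rcases quad_sublist_append hs with hs | ⟨ha, hs⟩ | ⟨hs', hs⟩ | ⟨hs, hd⟩ | hs
  · exact h₂ _ _ _ _ hs hq
  -- In each of the three patterns the first letter is below the last, so no occurrence can straddle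
  -- a skew sum.
  · have := h a ha d (hs.subset (by simp))
    unfold IsForbiddenQuad at hq; omega
  · have := h a (hs'.subset (by simp)) d (hs.subset (by simp))
    unfold IsForbiddenQuad at hq; omega
  · have := h a (hs.subset (by simp)) d hd
    unfold IsForbiddenQuad at hq; omega
  · exact h₁ _ _ _ _ hs hq

/-- Avoidance is kept by prepending an avoider that lies below the maximum of the second word, but
above everything else in it. -/
theorem AvoidsQuads.append_of_max {l₁ l₂ : List ℕ} {m : ℕ} (h₁ : AvoidsQuads l₁)
    (h₂ : AvoidsQuads l₂) (hm : ∀ x ∈ l₁, x < m) (h : ∀ x ∈ l₁, ∀ y ∈ l₂, y = m ∨ y < x) :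
    AvoidsQuads (l₁ ++ l₂) := by
  intro a b c d hs hq
  rcases quad_sublist_append hs with hs | ⟨ha, hs⟩ | ⟨hs', hs⟩ | ⟨hs, hd⟩ | hs
  · exact h₂ _ _ _ _ hs hq
  -- First below last forces `d = m`; but each pattern has a letter above its last one, and nothing
  -- here exceeds `m`.
  · have := h a ha d (hs.subset (by simp))
    have := h a ha b (hs.subset (by simp))
    have := h a ha c (hs.subset (by simp))
    unfold IsForbiddenQuad at hq; omega
  · have := h a (hs'.subset (by simp)) d (hs.subset (by simp))
    have := h a (hs'.subset (by simp)) c (hs.subset (by simp))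
    have := h b (hs'.subset (by simp)) c (hs.subset (by simp))
    have := h b (hs'.subset (by simp)) d (hs.subset (by simp))
    have := hm b (hs'.subset (by simp))
    unfold IsForbiddenQuad at hq; omega
  · have := h a (hs.subset (by simp)) d hd
    have := hm b (hs.subset (by simp))
    have := hm c (hs.subset (by simp))
    unfold IsForbiddenQuad at hq; omega
  · exact h₁ _ _ _ _ hs hq

theorem lt_of_pair_sublist {a b : ℕ} {l : List ℕ} (h : l.Pairwise (· < ·))
    (hs : [a, b].Sublist l) : a < b := by
  simpa using h.sublist hs

/-- No pattern begins with its largest letter, so `m` cannot lead an occurrence. An occurrence with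
exactly one letter in `S` is a `1342` whose `342` would be a `231` in `U`. With two or more letters
in `S` it would start with an ascent whose top is not above the last letter, which the increasing
`S` below `U` and `m` rules out. -/
theorem avoidsQuads_increasing_max {S U : List ℕ} {m : ℕ} (hS : S.Pairwise (· < ·))
    (hSU : ∀ x ∈ S, ∀ y ∈ U, x < y) (hSm : ∀ x ∈ S, x < m) (hUm : ∀ x ∈ U, x < m)
    (hU : AvoidsQuads U) (hU' : Avoids231 U) : AvoidsQuads (S ++ m :: U) := by
  intro a b c d hs hq
  have hmem : ∀ x ∈ S, ∀ y ∈ m :: U, x < y ∧ y ≤ m := fun x hx y hy => by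
    rcases List.mem_cons.1 hy with rfl | hy
    · exact ⟨hSm x hx, le_rfl⟩
    · exact ⟨hSU x hx y hy, (hUm y hy).le⟩
  rcases quad_sublist_append hs with hs | ⟨ha, hs⟩ | ⟨hs', hs⟩ | ⟨hs, hd⟩ | hs
  · rcases List.sublist_cons_iff.1 hs with h | ⟨r, hr, h⟩
    · exact hU _ _ _ _ h hq
    · obtain ⟨rfl, rfl⟩ := List.cons.inj hr
      have := hUm d (h.subset (by simp))
      unfold IsForbiddenQuad at hq; omega
  · have := hmem a ha b (hs.subset (by simp))
    have := hmem a ha c (hs.subset (by simp))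
    rcases List.sublist_cons_iff.1 hs with h | ⟨r, hr, h⟩
    · have := hU' _ _ _ h
      unfold IsForbiddenQuad at hq; omega
    · obtain ⟨rfl, rfl⟩ := List.cons.inj hr
      unfold IsForbiddenQuad at hq; omega
  · have := hmem b (hs'.subset (by simp)) d (hs.subset (by simp))
    have := hmem a (hs'.subset (by simp)) c (hs.subset (by simp))
    have := lt_of_pair_sublist hS hs'
    unfold IsForbiddenQuad at hq; omega
  · have := hmem b (hs.subset (by simp)) d hd
    have hab := lt_of_pair_sublist (a := a) (b := b) hS (List.Sublist.trans (by simp) hs)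
    have := hmem c (hs.subset (by simp)) d hd
    unfold IsForbiddenQuad at hq; omega
  · have h := hS.sublist hs
    simp at h
    unfold IsForbiddenQuad at hq; omega

/-! ### Splitting words by value -/

/-- A word in which no letter failing `p` precedes a letter satisfying `p` is the concatenation of
its two filters. -/
theorem eq_filter_append_filter_not {p : ℕ → Bool} :
    ∀ {l : List ℕ}, (∀ a b, [a, b].Sublist l → p a = false → p b = false) →
      l = l.filter p ++ l.filter (fun x => !p x)
  | [], _ => rfl
  | x :: l, h => by
    have ih := eq_filter_append_filter_not (p := p) (l := l)
      fun a b hs => h a b (hs.cons x)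
    cases hx : p x
    · have hall : ∀ y ∈ l, p y = false := fun y hy =>
        h x y (by simpa using hy) hx
      have h1 : l.filter p = [] := by
        simpa [List.filter_eq_nil_iff] using hall
      have h2 : l.filter (fun x => !p x) = l := by
        simpa [List.filter_eq_self] using hall
      simp [hx, h1, h2]
    · simp only [List.filter_cons, hx]
      simpa using ih

theorem eq_range'_of_pairwise {s n : ℕ} {l : List ℕ} (h : l.Perm (List.range' s n))
    (hl : l.Pairwise (· < ·)) : l = List.range' s n :=
  h.eq_of_pairwise (fun _ _ _ _ h1 h2 => absurd h1 h2.asymm) hl List.pairwise_lt_range'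

/-- Sorting each half separately already sorts the whole word, which must then be the interval
itself, cut at `l₁.length`. -/
theorem perm_range'_of_append {s n : ℕ} {l₁ l₂ : List ℕ}
    (h : (l₁ ++ l₂).Perm (List.range' s n)) (hlt : ∀ x ∈ l₁, ∀ y ∈ l₂, x < y) :
    l₁.Perm (List.range' s l₁.length) ∧ l₂.Perm (List.range' (s + l₁.length) l₂.length) := by
  have hn : l₁.length + l₂.length = n := by simpa using h.length_eq
  have hnd := h.nodup_iff.2 List.nodup_range'
  have hsort : ∀ l : List ℕ, l.Nodup → (l.insertionSort (· ≤ ·)).Pairwise (· < ·) :=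
    fun l hl => by
      have h1 := List.pairwise_insertionSort (· ≤ ·) l
      have h2 : (l.insertionSort (· ≤ ·)).Nodup := (List.perm_insertionSort _ l).nodup_iff.2 hl
      exact (h1.and h2).imp fun h => lt_of_le_of_ne h.1 h.2
  have p₁ := List.perm_insertionSort (· ≤ ·) l₁
  have p₂ := List.perm_insertionSort (· ≤ ·) l₂
  have heq := eq_range'_of_pairwise ((p₁.append p₂).trans h) (List.pairwise_append.2
    ⟨hsort _ (List.nodup_append.1 hnd).1, hsort _ (List.nodup_append.1 hnd).2.1,
      fun x hx y hy => hlt x (p₁.mem_iff.1 hx) y (p₂.mem_iff.1 hy)⟩)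
  rw [← hn, ← List.range'_append_1] at heq
  obtain ⟨e₁, e₂⟩ := List.append_inj heq (by simp)
  exact ⟨e₁ ▸ p₁.symm, e₂ ▸ p₂.symm⟩

/-! ### Avoiding words on an interval, and translation invariance -/

open Classical in
/-- The orderings of `s, …, s + n - 1` that avoid `1342`, `2143` and `2413`. -/
noncomputable def avoidingWords (s n : ℕ) : Finset (List ℕ) :=
  (List.range' s n).permutations.toFinset.filter AvoidsQuads

open Classical in
/-- The orderings of `s, …, s + n - 1` that avoid `231` and `2143`. -/
noncomputable def avoidingWords231 (s n : ℕ) : Finset (List ℕ) :=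
  (avoidingWords s n).filter Avoids231

theorem mem_avoidingWords {s n : ℕ} {l : List ℕ} :
    l ∈ avoidingWords s n ↔ l.Perm (List.range' s n) ∧ AvoidsQuads l := by
  simp [avoidingWords]

theorem mem_avoidingWords231 {s n : ℕ} {l : List ℕ} :
    l ∈ avoidingWords231 s n ↔ l.Perm (List.range' s n) ∧ AvoidsQuads l ∧ Avoids231 l := by
  simp [avoidingWords231, mem_avoidingWords, and_assoc]

theorem avoidsQuads_map_add {s : ℕ} {l : List ℕ} :
    AvoidsQuads (l.map (s + ·)) ↔ AvoidsQuads l := by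
  constructor
  · intro h a b c d hs hq
    refine h _ _ _ _ (hs.map (s + ·)) ?_
    unfold IsForbiddenQuad at *; dsimp only; omega
  · intro h a b c d hs hq
    obtain ⟨t, ht, he⟩ := List.sublist_map_iff.1 hs
    rcases t with _ | ⟨x, _ | ⟨y, _ | ⟨z, _ | ⟨w, _ | ⟨v, t⟩⟩⟩⟩⟩ <;> simp at he
    obtain ⟨rfl, rfl, rfl, rfl⟩ := he
    refine h _ _ _ _ ht ?_
    unfold IsForbiddenQuad at *; omega

theorem avoids231_map_add {s : ℕ} {l : List ℕ} :
    Avoids231 (l.map (s + ·)) ↔ Avoids231 l := by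
  constructor
  · intro h a b c hs hq
    exact h _ _ _ (hs.map (s + ·)) (by dsimp only; omega)
  · intro h a b c hs hq
    obtain ⟨t, ht, he⟩ := List.sublist_map_iff.1 hs
    rcases t with _ | ⟨x, _ | ⟨y, _ | ⟨z, _ | ⟨v, t⟩⟩⟩⟩ <;> simp at he
    obtain ⟨rfl, rfl, rfl⟩ := he
    exact h _ _ _ ht (by omega)

theorem exists_eq_map_add {s n : ℕ} {l : List ℕ} (h : l.Perm (List.range' s n)) :
    ∃ t : List ℕ, t.Perm (List.range' 0 n) ∧ t.map (s + ·) = l := by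
  refine ⟨l.map (· - s), ?_, ?_⟩
  · have := h.map (· - s)
    rwa [List.map_sub_range' le_rfl, Nat.sub_self] at this
  · rw [List.map_map]
    conv_rhs => rw [← List.map_id l]
    refine List.map_congr_left fun x hx => ?_
    have := h.mem_iff.1 hx
    simp at this ⊢
    omega

theorem pair_sublist_of_lt {a b : ℕ} {l : List ℕ} (h : l.Pairwise (· < ·)) (ha : a ∈ l)
    (hb : b ∈ l) (hab : a < b) : [a, b].Sublist l := by
  obtain ⟨s, t, rfl⟩ := List.append_of_mem ha
  have hbt : b ∈ t := by
    rw [List.mem_append, List.mem_cons] at hb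
    rcases hb with hb | rfl | hb
    · exact absurd ((List.pairwise_append.1 h).2.2 b hb a (by simp)) hab.asymm
    · exact absurd hab (lt_irrefl _)
    · exact hb
  exact (List.cons_sublist_cons.2 (List.singleton_sublist.2 hbt)).trans
    (List.sublist_append_right _ _)

theorem quad_sublist_middle {a b m d : ℕ} {L R : List ℕ} (h : [a, b].Sublist L) (hd : d ∈ R) :
    [a, b, m, d].Sublist (L ++ m :: R) :=
  h.append (List.cons_sublist_cons.2 (List.singleton_sublist.2 hd))

theorem map_add_perm_range' {s n : ℕ} {l : List ℕ} (h : l.Perm (List.range' 0 n)) :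
    (l.map (s + ·)).Perm (List.range' s n) := by
  simpa [List.map_add_range'] using h.map (s + ·)

/-- Translation preserves order, so a block contributes to the count through its length only. -/
theorem card_avoidingWords (s n : ℕ) : (avoidingWords s n).card = (avoidingWords 0 n).card := by
  have : avoidingWords s n = (avoidingWords 0 n).image (List.map (s + ·)) := by
    ext l
    simp only [Finset.mem_image, mem_avoidingWords]
    constructor
    · rintro ⟨h, h'⟩
      obtain ⟨t, ht, rfl⟩ := exists_eq_map_add h
      exact ⟨t, ⟨ht, avoidsQuads_map_add.1 h'⟩, rfl⟩
    · rintro ⟨t, ⟨ht, ht'⟩, rfl⟩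
      exact ⟨map_add_perm_range' ht, avoidsQuads_map_add.2 ht'⟩
  rw [this, Finset.card_image_of_injective _ (List.map_injective_iff.2 (add_right_injective s))]

theorem card_avoidingWords231 (s n : ℕ) :
    (avoidingWords231 s n).card = (avoidingWords231 0 n).card := by
  have : avoidingWords231 s n = (avoidingWords231 0 n).image (List.map (s + ·)) := by
    ext l
    simp only [Finset.mem_image, mem_avoidingWords231]
    constructor
    · rintro ⟨h, h', h''⟩
      obtain ⟨t, ht, rfl⟩ := exists_eq_map_add h
      exact ⟨t, ⟨ht, avoidsQuads_map_add.1 h', avoids231_map_add.1 h''⟩, rfl⟩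
    · rintro ⟨t, ⟨ht, ht', ht''⟩, rfl⟩
      exact ⟨map_add_perm_range' ht, avoidsQuads_map_add.2 ht', avoids231_map_add.2 ht''⟩
  rw [this, Finset.card_image_of_injective _ (List.map_injective_iff.2 (add_right_injective s))]

/-! ### The decomposition around the maximum -/

/-- Deleting the maximum from an ordering of `s, …, s + n`. -/
theorem perm_range'_succ_iff {s n : ℕ} {L R : List ℕ} :
    (L ++ (s + n) :: R).Perm (List.range' s (n + 1)) ↔ (L ++ R).Perm (List.range' s n) := by
  rw [List.range'_1_concat]
  constructor
  · intro h
    exact (List.perm_cons (s + n)).1 ((List.perm_middle.symm.trans h).trans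
      (List.perm_append_singleton _ _))
  · intro h
    exact List.perm_middle.trans ((h.cons _).trans (List.perm_append_singleton _ _).symm)

theorem exists_append_max {s n : ℕ} {l : List ℕ} (h : l.Perm (List.range' s (n + 1))) :
    ∃ L R, l = L ++ (s + n) :: R ∧ (L ++ R).Perm (List.range' s n) := by
  have hm : s + n ∈ l := h.mem_iff.2 (by simp)
  obtain ⟨L, R, rfl⟩ := List.append_of_mem hm
  exact ⟨L, R, rfl, perm_range'_succ_iff.1 h⟩

/-- Decomposition of an avoider of `1342`, `2143` and `2413` around its maximum. -/
theorem exists_decomposition {n : ℕ} {l : List ℕ} (hl : l ∈ avoidingWords 0 (n + 1)) :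
    ∃ (B : List ℕ) (k : ℕ) (U D : List ℕ), (k = 0 ↔ U = []) ∧
      (B.length + D.length) + (k + U.length) = n ∧
      B ∈ avoidingWords (D.length + k + U.length) B.length ∧
      U ∈ avoidingWords231 (D.length + k) U.length ∧ D ∈ avoidingWords 0 D.length ∧
      l = B ++ (List.range' D.length k ++ n :: (U ++ D)) := by
  classical
  obtain ⟨hp, hav⟩ := mem_avoidingWords.1 hl
  obtain ⟨L, R, rfl, hLR⟩ := exists_append_max hp
  rw [Nat.zero_add] at *
  have hlt : ∀ x ∈ L ++ R, x < n := fun x hx => by simpa using hLR.mem_iff.1 hx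
  have hnd : (L ++ R).Nodup := hLR.nodup_iff.2 List.nodup_range'
  have hne : ∀ x ∈ L, ∀ y ∈ R, x ≠ y := (List.nodup_append.1 hnd).2.2
  let p : ℕ → Bool := fun x => decide (∀ y ∈ R, y < x)
  have hLeq : L = L.filter p ++ L.filter (fun x => !p x) := by
    refine eq_filter_append_filter_not fun a b hs ha => ?_
    by_contra hb
    simp only [p, decide_eq_false_iff_not, not_not] at ha hb
    push Not at ha
    obtain ⟨y, hy, hay⟩ := ha
    have haL : a ∈ L := hs.subset (by simp)
    have hbL : b ∈ L := hs.subset (by simp)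
    have h1 := hb y hy
    have h2 := hlt b (by simp [hbL])
    have h3 := hne a haL y hy
    -- Here `a < y < b < n`, so `a b n y` is a `1342`: all of `B` precedes all of `S`.
    refine hav a b n y (quad_sublist_middle hs hy) (Or.inl ?_)
    omega
  set B := L.filter p with hB
  set S := L.filter (fun x => !p x) with hS
  have hBR : ∀ x ∈ B, ∀ y ∈ R, y < x := fun x hx => by
    simpa [p] using (List.mem_filter.1 hx).2
  have hSR : ∀ x ∈ S, ∃ y ∈ R, x < y := fun x hx => by
    obtain ⟨hxL, hx⟩ := List.mem_filter.1 hx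
    simp only [p, Bool.not_eq_true', decide_eq_false_iff_not, not_forall, not_lt] at hx
    obtain ⟨y, hy, hxy⟩ := hx
    exact ⟨y, hy, lt_of_le_of_ne hxy (hne x hxL y hy)⟩
  have hSL : S.Sublist L := List.filter_sublist
  have hSinc : S.Pairwise (· < ·) := by
    rw [List.pairwise_iff_forall_sublist]
    intro a b hs
    by_contra hab
    have hne' : a ≠ b := by
      have := (List.nodup_append.1 hnd).1.sublist (hs.trans hSL)
      simpa using this
    obtain ⟨y, hy, hay⟩ := hSR a (hs.subset (by simp))
    have h1 := hlt y (by simp [hy])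
    -- A descent `a b` in `S` gives the `2143` `a b n y`.
    refine hav a b n y (quad_sublist_middle (hs.trans hSL) hy)
      (Or.inr (Or.inl ?_))
    omega
  -- The negation makes `U` the first filter. For empty `S` the inner condition is vacuous, so `U`
  -- is empty and `D` is all of `R`.
  let q : ℕ → Bool := fun x => !decide (∀ y ∈ S, x < y)
  have hReq : R = R.filter q ++ R.filter (fun x => !q x) := by
    refine eq_filter_append_filter_not fun a b hs ha => ?_
    by_contra hb
    simp only [q, Bool.not_eq_false', decide_eq_true_eq] at ha hb
    push Not at hb
    obtain ⟨y, hy, hby⟩ := hb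
    have haR : a ∈ R := hs.subset (by simp)
    have hbR : b ∈ R := hs.subset (by simp)
    have h1 := ha y hy
    have h2 := hlt b (by simp [hbR])
    have h3 := hne y (hSL.subset hy) b hbR
    -- A letter `a` of `D` before a letter `b` of `U` gives the `2413` `y n a b`.
    refine hav y n a b (List.Sublist.append (List.singleton_sublist.2 (hSL.subset hy))
      (hs.cons_cons n)) (Or.inr (Or.inr ?_))
    omega
  set U := R.filter q with hU
  set D := R.filter (fun x => !q x) with hD
  have hDS : ∀ x ∈ D, ∀ y ∈ S, x < y := fun x hx => by
    simpa [q] using (List.mem_filter.1 hx).2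
  have hUR : U.Sublist R := List.filter_sublist
  have hDR : D.Sublist R := List.filter_sublist
  have hUne : ∀ x ∈ U, ∃ y ∈ S, y < x := fun x hx => by
    obtain ⟨hxR, hx⟩ := List.mem_filter.1 hx
    simp only [q, Bool.not_eq_true', decide_eq_false_iff_not, not_forall, not_lt] at hx
    obtain ⟨y, hy, hxy⟩ := hx
    exact ⟨y, hy, lt_of_le_of_ne hxy (hne y (hSL.subset hy) x hxR)⟩
  have hSU : ∀ x ∈ S, ∀ y ∈ U, x < y := fun x hx y hy => by
    by_contra hxy
    obtain ⟨z, hz, hzy⟩ := hUne y hy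
    have h1 := hne x (hSL.subset hx) y (hUR.subset hy)
    have h2 := hlt x (by simp [hSL.subset hx])
    have hs := pair_sublist_of_lt hSinc hz hx (by omega)
    -- If `y` in `U` lay between two letters `z < x` of `S`, then `z x n y` would be a `1342`.
    refine hav z x n y (quad_sublist_middle (hs.trans hSL) (hUR.subset hy))
      (Or.inl ?_)
    omega
  have hBS : ∀ x ∈ S, ∀ y ∈ B, x < y := fun x hx y hy => by
    obtain ⟨z, hz, hxz⟩ := hSR x hx
    exact hxz.trans (hBR y hy z hz)
  have hDU : ∀ x ∈ D, ∀ y ∈ U, x < y := fun x hx y hy => by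
    obtain ⟨z, hz, hzy⟩ := hUne y hy
    exact (hDS x hx z hz).trans hzy
  have hSU0 : S = [] ↔ U = [] := by
    constructor
    · intro h
      refine List.eq_nil_iff_forall_not_mem.2 fun x hx => ?_
      obtain ⟨z, hz, -⟩ := hUne x hx
      simp [h] at hz
    · intro h
      refine List.eq_nil_iff_forall_not_mem.2 fun x hx => ?_
      obtain ⟨z, hz, hxz⟩ := hSR x hx
      rw [hReq, h, List.nil_append] at hz
      exact absurd (hDS z hz x hx) hxz.asymm
  have hperm : (D ++ (S ++ (U ++ B))).Perm (List.range' 0 n) := by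
    refine List.Perm.trans ?_ hLR
    rw [hLeq, hReq]
    rw [List.perm_iff_count]
    intro a
    simp only [List.count_append]
    omega
  obtain ⟨hD1, hperm⟩ := perm_range'_of_append hperm (by
    intro x hx y hy
    simp only [List.mem_append] at hy
    rcases hy with hy | hy | hy
    · exact hDS x hx y hy
    · exact hDU x hx y hy
    · exact hBR y hy x (hDR.subset hx))
  obtain ⟨hS1, hperm⟩ := perm_range'_of_append hperm (by
    intro x hx y hy
    simp only [List.mem_append] at hy
    rcases hy with hy | hy
    · exact hSU x hx y hy
    · exact hBS x hx y hy)
  obtain ⟨hU1, hB1⟩ := perm_range'_of_append hperm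
    (fun x hx y hy => hBR y hy x (hUR.subset hx))
  rw [Nat.zero_add] at *
  have hSeq := eq_range'_of_pairwise hS1 hSinc
  have hLlen : L.length = B.length + S.length := by
    conv_lhs => rw [hLeq]
    simp
  have hRlen : R.length = U.length + D.length := by
    conv_lhs => rw [hReq]
    simp
  have hlen : L.length + R.length = n := by simpa using hLR.length_eq
  refine ⟨B, S.length, U, D, by simpa using hSU0, by omega,
    mem_avoidingWords.2 ⟨hB1, ?_⟩, mem_avoidingWords231.2 ⟨hU1, ?_, ?_⟩,
    mem_avoidingWords.2 ⟨hD1, ?_⟩, ?_⟩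
  · exact hav.sublist (List.filter_sublist.trans (List.sublist_append_left _ _))
  · exact hav.sublist (hUR.trans ((List.sublist_cons_self _ _).trans
      (List.sublist_append_right _ _)))
  · intro a b c hs hq
    obtain ⟨z, hz, hza⟩ := hUne c (hs.subset (by simp))
    -- A letter of `S` below `c` turns a `231` in `U` into a `1342`.
    refine hav z a b c (List.Sublist.append (List.singleton_sublist.2 (hSL.subset hz))
      ((hs.trans hUR).cons n)) (Or.inl ?_)
    omega
  · exact hav.sublist (hDR.trans ((List.sublist_cons_self _ _).trans
      (List.sublist_append_right _ _)))
  · rw [← hSeq, ← hReq, ← List.append_assoc, ← hLeq]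

theorem mem_avoidingWords_of_decomposition {n k : ℕ} {B U D : List ℕ}
    (hn : (B.length + D.length) + (k + U.length) = n)
    (hB : B ∈ avoidingWords (D.length + k + U.length) B.length)
    (hU : U ∈ avoidingWords231 (D.length + k) U.length) (hD : D ∈ avoidingWords 0 D.length) :
    B ++ (List.range' D.length k ++ n :: (U ++ D)) ∈ avoidingWords 0 (n + 1) := by
  obtain ⟨hBp, hB⟩ := mem_avoidingWords.1 hB
  obtain ⟨hUp, hU, hU'⟩ := mem_avoidingWords231.1 hU
  obtain ⟨hDp, hD⟩ := mem_avoidingWords.1 hD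
  have hBm : ∀ x ∈ B, D.length + k + U.length ≤ x ∧ x < n := fun x hx => by
    have := hBp.mem_iff.1 hx
    simp at this; omega
  have hUm : ∀ x ∈ U, D.length + k ≤ x ∧ x < D.length + k + U.length := fun x hx => by
    have := hUp.mem_iff.1 hx
    simp at this; omega
  have hDm : ∀ x ∈ D, x < D.length := fun x hx => by
    have := hDp.mem_iff.1 hx
    simpa using this
  have hSm : ∀ x ∈ List.range' D.length k, D.length ≤ x ∧ x < D.length + k := by simp
  refine mem_avoidingWords.2 ⟨?_, ?_⟩
  · have h := perm_range'_succ_iff (s := 0) (n := n) (L := B ++ List.range' D.length k)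
      (R := U ++ D)
    rw [Nat.zero_add, List.append_assoc] at h
    refine h.2 ?_
    have h1 : (B ++ List.range' D.length k ++ (U ++ D)).Perm
        (D ++ (List.range' D.length k ++ (U ++ B))) := by
      rw [List.perm_iff_count]
      intro a
      simp only [List.count_append]
      omega
    refine h1.trans ((hDp.append ((List.Perm.refl _).append (hUp.append hBp))).trans ?_)
    rw [List.range'_append_1, List.range'_append_1]
    have := List.range'_append_1 (s := 0) (m := D.length) (n := k + (U.length + B.length))
    rw [Nat.zero_add] at this
    rw [this]
    exact List.Perm.of_eq (by congr 1; omega)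
  · have hX := avoidsQuads_increasing_max (m := n) (List.pairwise_lt_range' (s := D.length) (n := k))
      (fun x hx y hy => lt_of_lt_of_le (hSm x hx).2 (hUm y hy).1)
      (fun x hx => by have := hSm x hx; omega) (fun x hx => by have := hUm x hx; omega) hU hU'
    have hXD := hX.append_of_gt hD (by
      intro x hx y hy
      have := hDm y hy
      simp only [List.mem_append, List.mem_cons] at hx
      rcases hx with hx | rfl | hx
      · have := hSm x hx; omega
      · omega
      · have := hUm x hx; omega)
    rw [List.append_assoc, List.cons_append] at hXD
    refine hB.append_of_max (m := n) hXD (fun x hx => (hBm x hx).2) ?_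
    intro x hx y hy
    have := hBm x hx
    simp only [List.mem_append, List.mem_cons] at hy
    rcases hy with hy | rfl | hy | hy
    · have := hSm y hy; omega
    · exact Or.inl rfl
    · have := hUm y hy; omega
    · have := hDm y hy; omega

theorem append_cons_inj_of_lt {m : ℕ} {L R L' R' : List ℕ} (hL : ∀ x ∈ L, x < m)
    (hL' : ∀ x ∈ L', x < m) (h : L ++ m :: R = L' ++ m :: R') : L = L' ∧ R = R' := by
  induction L generalizing L' with
  | nil =>
    rcases L' with _ | ⟨y, L'⟩
    · simpa using h
    · obtain ⟨rfl, -⟩ := List.cons.inj h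
      exact absurd (hL' m (by simp)) (lt_irrefl _)
  | cons x L ih =>
    rcases L' with _ | ⟨y, L'⟩
    · obtain ⟨rfl, -⟩ := List.cons.inj h
      exact absurd (hL x (by simp)) (lt_irrefl _)
    · rw [List.cons_append, List.cons_append, List.cons.injEq] at h
      obtain ⟨rfl, h'⟩ := h
      obtain ⟨rfl, rfl⟩ := ih (fun z hz => hL z (by simp [hz])) (fun z hz => hL' z (by simp [hz])) h'
      exact ⟨rfl, rfl⟩

theorem length_of_mem_avoidingWords {s n : ℕ} {l : List ℕ} (h : l ∈ avoidingWords s n) :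
    l.length = n := by
  simpa using (mem_avoidingWords.1 h).1.length_eq

theorem mem_range_of_mem_avoidingWords {s n : ℕ} {l : List ℕ} (h : l ∈ avoidingWords s n) :
    ∀ x ∈ l, s ≤ x ∧ x < s + n := fun x hx => by
  simpa using (mem_avoidingWords.1 h).1.mem_iff.1 hx

theorem avoidingWords231_subset {s n : ℕ} : avoidingWords231 s n ⊆ avoidingWords s n :=
  fun _ h => mem_avoidingWords.2 ⟨(mem_avoidingWords231.1 h).1, (mem_avoidingWords231.1 h).2.1⟩

theorem nil_mem_avoidingWords231 {s : ℕ} : [] ∈ avoidingWords231 s 0 :=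
  mem_avoidingWords231.2 ⟨by simp, fun _ _ _ _ h => by simp at h, fun _ _ _ h => by simp at h⟩

theorem avoidingWords_zero : avoidingWords 0 0 = {[]} := by
  ext l
  rw [Finset.mem_singleton]
  constructor
  · intro h
    exact List.length_eq_zero_iff.1 (length_of_mem_avoidingWords h)
  · rintro rfl
    exact avoidingWords231_subset nil_mem_avoidingWords231

theorem avoidingWords231_zero : avoidingWords231 0 0 = {[]} := by
  ext l
  rw [Finset.mem_singleton]
  constructor
  · intro h
    exact List.length_eq_zero_iff.1 (length_of_mem_avoidingWords (avoidingWords231_subset h))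
  · rintro rfl
    exact nil_mem_avoidingWords231

/-- `B` is recovered as the letters before `n` that exceed everything after it. This needs the
condition that `S` and `U` are empty together: without a larger `U`, letters of `S` could be counted
in `B`. -/
theorem decomposition_unique {n k k' : ℕ} {B U D B' U' D' : List ℕ}
    (hk : k = 0 ↔ U = []) (hk' : k' = 0 ↔ U' = [])
    (hn : (B.length + D.length) + (k + U.length) = n)
    (hn' : (B'.length + D'.length) + (k' + U'.length) = n)
    (hB : B ∈ avoidingWords (D.length + k + U.length) B.length)
    (hB' : B' ∈ avoidingWords (D'.length + k' + U'.length) B'.length)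
    (hU : U ∈ avoidingWords231 (D.length + k) U.length)
    (hU' : U' ∈ avoidingWords231 (D'.length + k') U'.length)
    (hD : D ∈ avoidingWords 0 D.length) (hD' : D' ∈ avoidingWords 0 D'.length)
    (h : B ++ (List.range' D.length k ++ n :: (U ++ D)) =
      B' ++ (List.range' D'.length k' ++ n :: (U' ++ D'))) :
    B = B' ∧ k = k' ∧ U = U' ∧ D = D' := by
  have hlow : ∀ (B U D : List ℕ) (k : ℕ), (B.length + D.length) + (k + U.length) = n →
      B ∈ avoidingWords (D.length + k + U.length) B.length →
      ∀ x ∈ B ++ List.range' D.length k, x < n := by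
    intro B U D k hn hB x hx
    rcases List.mem_append.1 hx with hx | hx
    · have := mem_range_of_mem_avoidingWords hB x hx; omega
    · simp at hx; omega
  have hfilter : ∀ (B U D : List ℕ) (k : ℕ), (k = 0 ↔ U = []) →
      B ∈ avoidingWords (D.length + k + U.length) B.length →
      U ∈ avoidingWords231 (D.length + k) U.length → D ∈ avoidingWords 0 D.length →
      (B ++ List.range' D.length k).filter (fun x => decide (∀ y ∈ U ++ D, y < x)) = B := by
    intro B U D k hk hB hU hD
    rw [List.filter_append, List.filter_eq_self.2, List.filter_eq_nil_iff.2, List.append_nil]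
    · intro x hx
      simp only [decide_eq_true_eq]
      intro hall
      rcases U with _ | ⟨y, U⟩
      · simp [hk.2 rfl] at hx
      · have h1 := hall y (by simp)
        have h2 := mem_range_of_mem_avoidingWords (avoidingWords231_subset hU) y (by simp)
        simp at hx; omega
    · intro x hx
      simp only [decide_eq_true_eq]
      intro y hy
      have h0 := mem_range_of_mem_avoidingWords hB x hx
      rcases List.mem_append.1 hy with hy | hy
      · have := mem_range_of_mem_avoidingWords (avoidingWords231_subset hU) y hy; omega
      · have := mem_range_of_mem_avoidingWords hD y hy; omega
  rw [← List.append_assoc, ← List.append_assoc] at h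
  obtain ⟨hl, hr⟩ := append_cons_inj_of_lt (hlow B U D k hn hB) (hlow B' U' D' k' hn' hB') h
  have hBB : B = B' := by
    have h1 := hfilter B U D k hk hB hU hD
    rw [hl, hr, hfilter B' U' D' k' hk' hB' hU' hD'] at h1
    exact h1.symm
  subst hBB
  have hS := List.append_cancel_left hl
  have hkk : k = k' := by simpa using congrArg List.length hS
  subst hkk
  have hDD : D.length = D'.length := by
    -- For empty `S` also `U` is empty, and `D` is everything after `n`; otherwise the first letter
    -- of `S` is `D.length`.
    rcases k with _ | k
    · rw [hk.1 rfl, hk'.1 rfl] at hr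
      simpa using congrArg List.length hr
    · rw [List.range'_succ, List.range'_succ] at hS
      exact (List.cons.inj hS).1
  obtain ⟨hUU, hDD⟩ := List.append_inj' hr hDD
  exact ⟨rfl, rfl, hUU, hDD⟩

/-! ### Counting avoiders by block sizes -/

/-- Sizes of the blocks in the decomposition of an avoider of length `n + 1`. -/
def blockSizes (n : ℕ) : Finset ((_ : ℕ × ℕ) × ((ℕ × ℕ) × (ℕ × ℕ))) :=
  (Finset.HasAntidiagonal.antidiagonal n).sigma fun i =>
    Finset.HasAntidiagonal.antidiagonal i.1 ×ˢ (Finset.HasAntidiagonal.antidiagonal i.2).filter fun j => j.1 = 0 ↔ j.2 = 0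

theorem mem_blockSizes {n : ℕ} {i : (_ : ℕ × ℕ) × ((ℕ × ℕ) × (ℕ × ℕ))} :
    i ∈ blockSizes n ↔ i.1.1 + i.1.2 = n ∧ i.2.1.1 + i.2.1.2 = i.1.1 ∧
      i.2.2.1 + i.2.2.2 = i.1.2 ∧ (i.2.2.1 = 0 ↔ i.2.2.2 = 0) := by
  simp [blockSizes]

/-- The blocks `B`, `U`, `D` of prescribed sizes. -/
noncomputable def blocks (p : (ℕ × ℕ) × (ℕ × ℕ)) : Finset (List ℕ × List ℕ × List ℕ) :=
  avoidingWords (p.1.2 + p.2.1 + p.2.2) p.1.1 ×ˢ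
    avoidingWords231 (p.1.2 + p.2.1) p.2.2 ×ˢ avoidingWords 0 p.1.2

/-- Assembling blocks to an avoider. -/
def assemble (n k : ℕ) (t : List ℕ × List ℕ × List ℕ) : List ℕ :=
  t.1 ++ (List.range' t.2.2.length k ++ n :: (t.2.1 ++ t.2.2))

theorem mem_blocks {p : (ℕ × ℕ) × (ℕ × ℕ)} {t : List ℕ × List ℕ × List ℕ} (h : t ∈ blocks p) :
    t.1.length = p.1.1 ∧ t.2.1.length = p.2.2 ∧ t.2.2.length = p.1.2 ∧
      t.1 ∈ avoidingWords (t.2.2.length + p.2.1 + t.2.1.length) t.1.length ∧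
      t.2.1 ∈ avoidingWords231 (t.2.2.length + p.2.1) t.2.1.length ∧
      t.2.2 ∈ avoidingWords 0 t.2.2.length := by
  simp only [blocks, Finset.mem_product] at h
  obtain ⟨hB, hU, hD⟩ := h
  have h1 := length_of_mem_avoidingWords hB
  have h2 := length_of_mem_avoidingWords (avoidingWords231_subset hU)
  have h3 := length_of_mem_avoidingWords hD
  rw [h1, h2, h3]
  exact ⟨rfl, rfl, rfl, hB, hU, hD⟩

theorem assemble_inj {n : ℕ} {i i' : (_ : ℕ × ℕ) × ((ℕ × ℕ) × (ℕ × ℕ))}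
    {t t' : List ℕ × List ℕ × List ℕ} (hi : i ∈ blockSizes n) (hi' : i' ∈ blockSizes n)
    (ht : t ∈ blocks i.2) (ht' : t' ∈ blocks i'.2)
    (h : assemble n i.2.2.1 t = assemble n i'.2.2.1 t') : i = i' ∧ t = t' := by
  rw [mem_blockSizes] at hi hi'
  obtain ⟨l1, l2, l3, hB, hU, hD⟩ := mem_blocks ht
  obtain ⟨l1', l2', l3', hB', hU', hD'⟩ := mem_blocks ht'
  obtain ⟨e1, e2, e3, e4⟩ := decomposition_unique
    (by rw [← List.length_eq_zero_iff, l2]; exact hi.2.2.2)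
    (by rw [← List.length_eq_zero_iff, l2']; exact hi'.2.2.2)
    (by omega) (by omega) hB hB' hU hU' hD hD' h
  have ht : t = t' := Prod.ext e1 (Prod.ext e3 e4)
  subst ht
  obtain ⟨⟨x, y⟩, ⟨b, d⟩, ⟨k, u⟩⟩ := i
  obtain ⟨⟨x', y'⟩, ⟨b', d'⟩, ⟨k', u'⟩⟩ := i'
  simp only at *
  obtain rfl : b = b' := by omega
  obtain rfl : d = d' := by omega
  obtain rfl : k = k' := by omega
  obtain rfl : u = u' := by omega
  obtain rfl : x = x' := by omega
  obtain rfl : y = y' := by omega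
  simp

theorem avoidingWords_succ (n : ℕ) :
    avoidingWords 0 (n + 1) =
      (blockSizes n).biUnion fun i => (blocks i.2).image (assemble n i.2.2.1) := by
  ext l
  simp only [Finset.mem_biUnion, Finset.mem_image]
  constructor
  · intro h
    obtain ⟨B, k, U, D, hk, hn, hB, hU, hD, rfl⟩ := exists_decomposition h
    refine ⟨⟨(B.length + D.length, k + U.length), (B.length, D.length), (k, U.length)⟩,
      mem_blockSizes.2 ⟨hn, rfl, rfl, by simpa using hk⟩, (B, U, D), ?_, rfl⟩
    simp only [blocks, Finset.mem_product]
    exact ⟨hB, hU, hD⟩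
  · rintro ⟨i, hi, t, ht, rfl⟩
    rw [mem_blockSizes] at hi
    obtain ⟨l1, l2, l3, hB, hU, hD⟩ := mem_blocks ht
    exact mem_avoidingWords_of_decomposition (by omega) hB hU hD

theorem card_avoidingWords_succ (n : ℕ) :
    (avoidingWords 0 (n + 1)).card = ∑ i ∈ Finset.HasAntidiagonal.antidiagonal n,
      (∑ p ∈ Finset.HasAntidiagonal.antidiagonal i.1, (avoidingWords 0 p.1).card * (avoidingWords 0 p.2).card) *
        ∑ p ∈ (Finset.HasAntidiagonal.antidiagonal i.2).filter (fun p => p.1 = 0 ↔ p.2 = 0),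
          (avoidingWords231 0 p.2).card := by
  rw [avoidingWords_succ, Finset.card_biUnion]
  · rw [blockSizes, Finset.sum_sigma]
    refine Finset.sum_congr rfl fun i hi => ?_
    rw [Finset.sum_mul_sum, Finset.sum_product]
    refine Finset.sum_congr rfl fun p hp => Finset.sum_congr rfl fun r hr => ?_
    have hmem : (⟨i, p, r⟩ : (_ : ℕ × ℕ) × ((ℕ × ℕ) × (ℕ × ℕ))) ∈ blockSizes n := by
      simp only [blockSizes, Finset.mem_sigma, Finset.mem_product]
      exact ⟨hi, hp, hr⟩
    rw [Finset.card_image_of_injOn fun t ht t' ht' h => (assemble_inj hmem hmem ht ht' h).2]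
    rw [blocks, Finset.card_product, Finset.card_product, card_avoidingWords,
      card_avoidingWords231]
    ring
  · intro i hi i' hi' hne
    rw [Function.onFun, Finset.disjoint_left]
    intro l hl hl'
    obtain ⟨t, ht, rfl⟩ := Finset.mem_image.1 hl
    obtain ⟨t', ht', h⟩ := Finset.mem_image.1 hl'
    exact hne (assemble_inj hi hi' ht ht' h.symm).1

/-! ### Words that also avoid `231` -/

/-- If letters follow the maximum, avoiding `231` puts all letters before it below those after it,
and avoiding `2143` makes the former increasing. The condition `p.2 ≠ 0` keeps the words ending in
`n` out of the second family. -/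
theorem avoidingWords231_succ (n : ℕ) :
    avoidingWords231 0 (n + 1) = (avoidingWords231 0 n).image (· ++ [n]) ∪
      ((Finset.HasAntidiagonal.antidiagonal n).filter (fun p => p.2 ≠ 0)).biUnion fun p =>
        (avoidingWords231 p.1 p.2).image (fun R => List.range' 0 p.1 ++ n :: R) := by
  ext l
  simp only [Finset.mem_union, Finset.mem_biUnion, Finset.mem_image, Finset.mem_filter,
    Finset.HasAntidiagonal.mem_antidiagonal]
  constructor
  · intro h
    obtain ⟨hp, hav, h231⟩ := mem_avoidingWords231.1 h
    obtain ⟨L, R, rfl, hLR⟩ := exists_append_max hp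
    rw [Nat.zero_add] at *
    have hlt : ∀ x ∈ L ++ R, x < n := fun x hx => by simpa using hLR.mem_iff.1 hx
    have hnd : (L ++ R).Nodup := hLR.nodup_iff.2 List.nodup_range'
    by_cases hR : R = []
    · subst hR
      rw [List.append_nil] at hLR
      exact Or.inl ⟨L, mem_avoidingWords231.2 ⟨hLR, hav.sublist (List.sublist_append_left _ _),
        h231.sublist (List.sublist_append_left _ _)⟩, rfl⟩
    · right
      have hlt' : ∀ x ∈ L, ∀ y ∈ R, x < y := fun x hx y hy => by
        have h1 := (List.nodup_append.1 hnd).2.2 x hx y hy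
        have h2 := hlt x (by simp [hx])
        have h3 := h231 x n y (List.Sublist.append (List.singleton_sublist.2 hx)
          (List.cons_sublist_cons.2 (List.singleton_sublist.2 hy)))
        omega
      obtain ⟨hL, hR'⟩ := perm_range'_of_append hLR hlt'
      rw [Nat.zero_add] at hR'
      obtain ⟨y, hy⟩ := List.exists_mem_of_ne_nil R hR
      have hinc : L.Pairwise (· < ·) := by
        rw [List.pairwise_iff_forall_sublist]
        intro a b hs
        by_contra hab
        have hne : a ≠ b := by
          have := (List.nodup_append.1 hnd).1.sublist hs
          simpa using this
        have h1 := hlt y (by simp [hy])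
        have h2 := hlt' a (hs.subset (by simp)) y hy
        refine hav a b n y (quad_sublist_middle hs hy) (Or.inr (Or.inl ?_))
        omega
      have hsub : R.Sublist (L ++ n :: R) :=
        (List.sublist_cons_self _ _).trans (List.sublist_append_right _ _)
      refine ⟨(L.length, R.length), ⟨by simpa using hLR.length_eq, by simpa using hR⟩, R,
        mem_avoidingWords231.2 ⟨hR', hav.sublist hsub, h231.sublist hsub⟩, ?_⟩
      simp only
      rw [← eq_range'_of_pairwise hL hinc]
  · rintro (⟨L, hL, rfl⟩ | ⟨⟨k, u⟩, ⟨hku, hu⟩, R, hR, rfl⟩)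
    · have hlt := mem_range_of_mem_avoidingWords (avoidingWords231_subset hL)
      obtain ⟨hp, hav, h231⟩ := mem_avoidingWords231.1 hL
      refine mem_avoidingWords231.2 ⟨?_, ?_, ?_⟩
      · have := perm_range'_succ_iff (s := 0) (n := n) (L := L) (R := [])
        rw [Nat.zero_add, List.append_nil] at this
        exact this.2 hp
      · refine hav.append_of_max (m := n) (fun _ _ _ _ h => by simp at h)
          (fun x hx => by simpa using (hlt x hx).2) (by simp)
      · intro a b c hs hq
        rcases triple_sublist_append hs with h | ⟨ha, h⟩ | ⟨h, hc⟩ | h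
        · simp at h
        · simp at h
        · have := hlt a (h.subset (by simp))
          simp at hc
          omega
        · exact h231 _ _ _ h hq
    · have hlt := mem_range_of_mem_avoidingWords (avoidingWords231_subset hR)
      obtain ⟨hp, hav, h231⟩ := mem_avoidingWords231.1 hR
      simp only at *
      refine mem_avoidingWords231.2 ⟨?_, ?_, ?_⟩
      · have := perm_range'_succ_iff (s := 0) (n := n) (L := List.range' 0 k) (R := R)
        rw [Nat.zero_add] at this
        refine this.2 (((List.Perm.refl _).append hp).trans ?_)
        have := List.range'_append_1 (s := 0) (m := k) (n := u)
        rw [Nat.zero_add] at this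
        rw [this, hku]
      · refine avoidsQuads_increasing_max List.pairwise_lt_range' ?_ ?_ ?_ hav h231
        · intro x hx y hy
          have := hlt y hy
          simp at hx; omega
        · intro x hx
          simp at hx; omega
        · intro x hx
          have := hlt x hx; omega
      · have hS : ∀ x ∈ List.range' 0 k, ∀ y ∈ n :: R, x < y := by
          intro x hx y hy
          simp at hx
          rcases List.mem_cons.1 hy with rfl | hy
          · omega
          · have := hlt y hy; omega
        intro a b c hs hq
        rcases triple_sublist_append hs with h | ⟨ha, h⟩ | ⟨h, hc⟩ | h
        · rcases List.sublist_cons_iff.1 h with h | ⟨r, hr, h⟩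
          · exact h231 _ _ _ h hq
          · obtain ⟨rfl, rfl⟩ := List.cons.inj hr
            have := hlt b (h.subset (by simp)); omega
        · have := hS a ha c (h.subset (by simp)); omega
        · have := hS a (h.subset (by simp)) c hc; omega
        · have := List.Pairwise.sublist h (List.pairwise_lt_range' (s := 0) (n := k))
          simp at this; omega

theorem card_avoidingWords231_succ (n : ℕ) :
    (avoidingWords231 0 (n + 1)).card = (avoidingWords231 0 n).card +
      ∑ p ∈ (Finset.HasAntidiagonal.antidiagonal n).filter (fun p => p.2 ≠ 0), (avoidingWords231 0 p.2).card := by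
  have key : ∀ (k k' : ℕ) (R R' : List ℕ), k ≤ n → k' ≤ n →
      List.range' 0 k ++ n :: R = List.range' 0 k' ++ n :: R' → k = k' ∧ R = R' := by
    intro k k' R R' hk hk' h
    obtain ⟨h1, h2⟩ := append_cons_inj_of_lt (by simp; omega) (by simp; omega) h
    exact ⟨by simpa using congrArg List.length h1, h2⟩
  rw [avoidingWords231_succ, Finset.card_union_of_disjoint, Finset.card_image_of_injective _
    (List.append_left_injective _), Finset.card_biUnion]
  · congr 1
    refine Finset.sum_congr rfl fun p hp => ?_
    have hp : p.1 ≤ n := by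
      have := Finset.HasAntidiagonal.mem_antidiagonal.1 (Finset.mem_filter.1 hp).1
      omega
    rw [Finset.card_image_of_injective _ fun R R' h => (key _ _ _ _ hp hp h).2,
      card_avoidingWords231]
  · intro p hp p' hp' hne
    rw [Function.onFun, Finset.disjoint_left]
    intro l hl hl'
    obtain ⟨R, hR, rfl⟩ := Finset.mem_image.1 hl
    obtain ⟨R', hR', h⟩ := Finset.mem_image.1 hl'
    have hp := Finset.HasAntidiagonal.mem_antidiagonal.1 (Finset.mem_filter.1 hp).1
    have hp' := Finset.HasAntidiagonal.mem_antidiagonal.1 (Finset.mem_filter.1 hp').1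
    have := (key _ _ _ _ (by omega) (by omega) h).1
    exact hne (Prod.ext this.symm (by omega))
  · rw [Finset.disjoint_left]
    intro l hl hl'
    obtain ⟨L, hL, rfl⟩ := Finset.mem_image.1 hl
    obtain ⟨p, hp, hl'⟩ := Finset.mem_biUnion.1 hl'
    obtain ⟨R, hR, h⟩ := Finset.mem_image.1 hl'
    obtain ⟨hp, hp2⟩ := Finset.mem_filter.1 hp
    have := Finset.HasAntidiagonal.mem_antidiagonal.1 hp
    have hR := length_of_mem_avoidingWords (avoidingWords231_subset hR)
    obtain ⟨-, rfl⟩ := append_cons_inj_of_lt (by simp; omega) (fun x hx => by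
      simpa using (mem_range_of_mem_avoidingWords (avoidingWords231_subset hL) x hx).2) h
    exact hp2 (by simpa using hR.symm)

/-! ### From permutations to words -/

theorem sublist_ofFn_iff {n : ℕ} {f : Fin n → ℕ} {s : List ℕ} :
    s.Sublist (List.ofFn f) ↔
      ∃ p : Fin s.length → Fin n, StrictMono p ∧ ∀ i, s.get i = f (p i) := by
  rw [List.sublist_iff_exists_fin_orderEmbedding_get_eq]
  constructor
  · rintro ⟨g, hg⟩
    refine ⟨fun i => (g i).cast (by simp), fun i j hij => ?_, fun i => ?_⟩
    · exact Fin.lt_def.2 (Fin.lt_def.1 (g.strictMono hij))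
    · exact (hg i).trans (List.get_ofFn _ _)
  · rintro ⟨p, hp, h⟩
    refine ⟨OrderEmbedding.ofStrictMono (fun i => (p i).cast (by simp)) fun i j hij => ?_,
      fun i => ?_⟩
    · exact Fin.lt_def.2 (Fin.lt_def.1 (hp hij))
    · exact (h i).trans (List.get_ofFn f ((p i).cast (by simp))).symm

/-- The one-line notation of a permutation. -/
def oneLine {n : ℕ} (π : Equiv.Perm (Fin n)) : List ℕ := List.ofFn fun i => (π i : ℕ)

theorem oneLine_injective {n : ℕ} : Function.Injective (oneLine (n := n)) := fun _ _ h =>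
  Equiv.ext fun i => Fin.ext (congrFun (List.ofFn_injective h) i)

theorem oneLine_perm {n : ℕ} (π : Equiv.Perm (Fin n)) : (oneLine π).Perm (List.range' 0 n) := by
  rw [oneLine, List.perm_ext_iff_of_nodup
    (List.nodup_ofFn.2 fun i j h => π.injective (Fin.ext h)) List.nodup_range']
  intro a
  simp only [List.mem_ofFn, List.mem_range'_1, Nat.zero_le, Nat.zero_add,
    true_and]
  constructor
  · rintro ⟨i, rfl⟩
    exact (π i).2
  · intro h
    exact ⟨π.symm ⟨a, h⟩, by simp⟩

theorem exists_oneLine_eq {n : ℕ} {l : List ℕ} (h : l.Perm (List.range' 0 n)) :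
    ∃ π : Equiv.Perm (Fin n), oneLine π = l := by
  have hlen : l.length = n := by simpa using h.length_eq
  subst hlen
  have hnd : l.Nodup := h.nodup_iff.2 List.nodup_range'
  have hlt : ∀ i : Fin l.length, l.get i < l.length := fun i => by
    simpa using h.mem_iff.1 (l.get_mem i)
  let f : Fin l.length → Fin l.length := fun i => ⟨l.get i, hlt i⟩
  have hf : Function.Injective f := fun i j hij =>
    List.nodup_iff_injective_get.1 hnd (Fin.mk.inj hij)
  refine ⟨Equiv.ofBijective f (Finite.injective_iff_bijective.1 hf), ?_⟩
  exact List.ofFn_get l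

theorem containsPattern_iff {n : ℕ} (π : Equiv.Perm (Fin n)) (τ : Fin 4 → ℕ) :
    ContainsPattern π τ ↔ ∃ w : Fin 4 → ℕ, [w 0, w 1, w 2, w 3].Sublist (oneLine π) ∧
      ∀ i j, w i < w j ↔ τ i < τ j := by
  constructor
  · rintro ⟨p, hp, h⟩
    refine ⟨fun i => π (p i), sublist_ofFn_iff.2 ⟨p, hp, fun i => ?_⟩, h⟩
    fin_cases i <;> rfl
  · rintro ⟨w, hw, h⟩
    obtain ⟨p, hp, hwp⟩ := sublist_ofFn_iff.1 hw
    have hwp : ∀ i : Fin 4, w i = π (p i) := fun i => by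
      have := hwp i
      fin_cases i <;> exact this
    exact ⟨p, hp, fun i j => by rw [← h, hwp, hwp, Fin.lt_def]⟩

theorem mem_avoiders_iff {n : ℕ} (π : Equiv.Perm (Fin n)) :
    π ∈ avoiders {![1, 3, 4, 2], ![2, 1, 4, 3], ![2, 4, 1, 3]} n ↔ AvoidsQuads (oneLine π) := by
  simp only [avoiders, Set.mem_ofPred_eq, Set.mem_insert_iff, Set.mem_singleton_iff,
    forall_eq_or_imp, forall_eq, containsPattern_iff, not_exists, not_and]
  constructor
  · rintro ⟨h1, h2, h3⟩ a b c d hs hq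
    rcases hq with hq | hq | hq
    · refine h1 ![a, b, c, d] hs ?_
      simp [Fin.forall_fin_succ]; omega
    · refine h2 ![a, b, c, d] hs ?_
      simp [Fin.forall_fin_succ]; omega
    · refine h3 ![a, b, c, d] hs ?_
      simp [Fin.forall_fin_succ]; omega
  · intro h
    refine ⟨fun w hs hw => h _ _ _ _ hs (Or.inl ?_),
      fun w hs hw => h _ _ _ _ hs (Or.inr (Or.inl ?_)),
      fun w hs hw => h _ _ _ _ hs (Or.inr (Or.inr ?_))⟩
    · exact ⟨(hw 0 3).2 (by simp), (hw 3 1).2 (by simp), (hw 1 2).2 (by simp)⟩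
    · exact ⟨(hw 1 0).2 (by simp), (hw 0 3).2 (by simp), (hw 3 2).2 (by simp)⟩
    · exact ⟨(hw 2 0).2 (by simp), (hw 0 3).2 (by simp), (hw 3 1).2 (by simp)⟩

theorem ncard_avoiders (n : ℕ) :
    (avoiders {![1, 3, 4, 2], ![2, 1, 4, 3], ![2, 4, 1, 3]} n).ncard =
      (avoidingWords 0 n).card := by
  rw [← Set.ncard_image_of_injective _ oneLine_injective, ← Set.ncard_coe_finset]
  congr 1
  ext l
  simp only [Set.mem_image, Finset.mem_coe, mem_avoidingWords, mem_avoiders_iff]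
  constructor
  · rintro ⟨π, h, rfl⟩
    exact ⟨oneLine_perm π, h⟩
  · rintro ⟨hp, h⟩
    obtain ⟨π, rfl⟩ := exists_oneLine_eq hp
    exact ⟨π, h, rfl⟩

/-! ### Generating functions -/

/-- The generating function of the words avoiding `231` and `2143`. -/
noncomputable def gf231 : ℚ⟦X⟧ := PowerSeries.mk fun n => ((avoidingWords231 0 n).card : ℚ)

theorem coeff_gf231_sub_one (n : ℕ) :
    coeff n (gf231 - 1) = if n = 0 then 0 else ((avoidingWords231 0 n).card : ℚ) := by
  rw [map_sub, gf231, coeff_mk, coeff_one]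
  split_ifs with h
  · simp [h, avoidingWords231_zero]
  · simp

theorem gf231_eq : gf231 = 1 + X * (gf231 + PowerSeries.mk 1 * (gf231 - 1)) := by
  ext n
  rcases n with _ | n
  · simp [gf231, avoidingWords231_zero]
  · rw [map_add, coeff_succ_X_mul, map_add, coeff_mul, coeff_one, if_neg n.succ_ne_zero, zero_add]
    simp only [coeff_gf231_sub_one]
    rw [gf231, coeff_mk, coeff_mk, card_avoidingWords231_succ]
    push_cast
    rw [Finset.sum_filter]
    congr 1
    refine Finset.sum_congr rfl fun p _ => ?_
    by_cases h : p.2 = 0 <;> simp [h]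

theorem gf231_sub_one_mul : (1 - 3 * X + X ^ 2) * (gf231 - 1) = X * (1 - X) := by
  have h1 : (PowerSeries.mk 1 : ℚ⟦X⟧) * (1 - X) = 1 := PowerSeries.mk_one_mul_one_sub_eq_one ℚ
  linear_combination (1 - X) * gf231_eq + X * (gf231 - 1) * h1

/-- `S` and `U` are both empty (the summand `1`) or both nonempty; `PowerSeries.mk 1 - 1` has one
nonempty increasing `S` for each length. -/
theorem coeff_mk_one_sub_one_mul (j : ℕ) :
    coeff j (1 + (PowerSeries.mk 1 - 1) * (gf231 - 1)) =
      ∑ p ∈ (Finset.HasAntidiagonal.antidiagonal j).filter (fun p => p.1 = 0 ↔ p.2 = 0),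
        ((avoidingWords231 0 p.2).card : ℚ) := by
  rcases j with _ | j
  · simp [avoidingWords231_zero, Finset.sum_filter, gf231]
  · rw [map_add, coeff_mul, coeff_one, if_neg j.succ_ne_zero, zero_add, Finset.sum_filter]
    simp only [coeff_gf231_sub_one]
    refine Finset.sum_congr rfl fun p hp => ?_
    have hp := Finset.HasAntidiagonal.mem_antidiagonal.1 hp
    rw [map_sub, coeff_mk, coeff_one, Pi.one_apply]
    by_cases h1 : p.1 = 0 <;> by_cases h2 : p.2 = 0
    · omega
    all_goals simp [h1, h2]

/-- The factor `X` marks the maximum, the square accounts for `B` and `D`, and the last factor for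
the pair `S`, `U`. -/
theorem avoiderGF_eq :
    avoiderGF {![1, 3, 4, 2], ![2, 1, 4, 3], ![2, 4, 1, 3]} =
      1 + X * (avoiderGF {![1, 3, 4, 2], ![2, 1, 4, 3], ![2, 4, 1, 3]} ^ 2 *
        (1 + (PowerSeries.mk 1 - 1) * (gf231 - 1))) := by
  simp only [avoiderGF, ncard_avoiders]
  ext n
  rcases n with _ | n
  · simp [avoidingWords_zero]
  · rw [map_add, coeff_succ_X_mul, coeff_mul, coeff_one, if_neg n.succ_ne_zero, zero_add,
      coeff_mk, card_avoidingWords_succ]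
    push_cast
    refine Finset.sum_congr rfl fun i _ => ?_
    rw [coeff_mk_one_sub_one_mul, pow_two, coeff_mul]
    simp only [coeff_mk]

theorem avoiderGF_quadratic :
    (1 - 3 * X + X ^ 2) * avoiderGF {![1, 3, 4, 2], ![2, 1, 4, 3], ![2, 4, 1, 3]} =
      1 - 3 * X + X ^ 2 + X * (1 - X) * (1 - 2 * X) *
        avoiderGF {![1, 3, 4, 2], ![2, 1, 4, 3], ![2, 4, 1, 3]} ^ 2 := by
  have h1 : (PowerSeries.mk 1 : ℚ⟦X⟧) * (1 - X) = 1 := PowerSeries.mk_one_mul_one_sub_eq_one ℚ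
  have hF := avoiderGF_eq
  set F := avoiderGF {![1, 3, 4, 2], ![2, 1, 4, 3], ![2, 4, 1, 3]} with hFdef
  linear_combination (1 - 3 * X + X ^ 2) * hF +
    X * F ^ 2 * (PowerSeries.mk 1 - 1) * gf231_sub_one_mul + X * F ^ 2 * X * h1

theorem mainTheorem11 :
    ∃ R : ℚ⟦X⟧,
      R ^ 2 = (1 - 7 * X + 13 * X ^ 2 - 8 * X ^ 3) * (1 - 3 * X + X ^ 2) ∧
      PowerSeries.constantCoeff R = 1 ∧
      ((avoiderGF {![1, 3, 4, 2], ![2, 1, 4, 3], ![2, 4, 1, 3]} : ℚ⟦X⟧) : LaurentSeries ℚ) =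
        ((1 - 3 * X + X ^ 2 - R : ℚ⟦X⟧) : LaurentSeries ℚ) /
          ((2 * X * (1 - X) * (1 - 2 * X) : ℚ⟦X⟧) : LaurentSeries ℚ) := by
  have hquad := avoiderGF_quadratic
  set F := avoiderGF {![1, 3, 4, 2], ![2, 1, 4, 3], ![2, 4, 1, 3]} with hF
  -- The root is the closed formula solved for `R`; its square is the discriminant of the quadratic.
  refine ⟨1 - 3 * X + X ^ 2 - 2 * X * (1 - X) * (1 - 2 * X) * F, ?_, by simp, ?_⟩
  · linear_combination (-4 * (X * (1 - X) * (1 - 2 * X))) * hquad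
  -- The denominator has zero constant term, so it is no unit among power series; being nonzero, it
  -- is invertible among Laurent series.
  · have hne : (2 * X * (1 - X) * (1 - 2 * X) : ℚ⟦X⟧) ≠ 0 := by
      have h2 : (2 : ℚ⟦X⟧) ≠ 0 := fun h => by
        have := congrArg PowerSeries.constantCoeff h
        rw [map_ofNat, map_zero] at this
        norm_num at this
      have h3 : (1 - X : ℚ⟦X⟧) ≠ 0 := fun h => by
        simpa using congrArg PowerSeries.constantCoeff h
      have h4 : (1 - 2 * X : ℚ⟦X⟧) ≠ 0 := fun h => by
        simpa using congrArg PowerSeries.constantCoeff h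
      exact mul_ne_zero (mul_ne_zero (mul_ne_zero h2 X_ne_zero) h3) h4
    have hne' : ((2 * X * (1 - X) * (1 - 2 * X) : ℚ⟦X⟧) : LaurentSeries ℚ) ≠ 0 := fun h =>
      hne (HahnSeries.ofPowerSeries_injective (by rw [h, map_zero]))
    rw [eq_div_iff hne', sub_sub_cancel, mul_comm, ← PowerSeries.coe_mul]
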